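/- Let $R$ be an integral domain with quotient field $K$, and let $F(R)$ be the set of nonzero fractional ideals of $R$. A star operation on $R$ is a map $I\mapsto I^\ast$ on $F(R)$ such that, for all $I,J\in F(R)$ and $0\neq a\in K$: $R^\ast=R$, $(aI)^\ast=aI^\ast$, $I\subseteq I^\ast$, $I\subseteq J\Rightarrow I^\ast\subseteq J^\ast$, and $I^{\ast\ast}=I^\ast$. It is of finite type if $I^\ast=\bigcup\{J^\ast : J\subseteq I,\ J\in F(R) \text{ finitely generated}\}$ for all $I\in F(R)$. The $t$-operation is the finite type star operation $I_t=\bigcup\{(J^{-1})^{-1} : J\subseteq I,\ J\in F(R)\text{ finitely generated}\}$, where $J^{-1}=(R:J)=\{x\in K: xJ\subseteq R\}$. Below all $\ast$-ideals are integral: a $\ast$-ideal is a nonzero ideal $I\subseteq R$ with $I^\ast=I$, and it is proper if $I\neq R$. A $\ast$-prime is a prime ideal that is a $\ast$-ideal; a $\ast$-maximal ideal is a maximal element of the set of proper $\ast$-ideals. Ideals $I,J$ are $\ast$-comaximal if $(I+J)^\ast=R$; $I$ is $\ast$-invertible if $(II^{-1})^\ast=R$; the $\ast$-product of $Q_1,\dots,Q_n$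 is $(Q_1\cdots Q_n)^\ast$. A $\ast$-packet is a $\ast$-invertible $\ast$-ideal with exactly one minimal prime. $R$ is a $\ast$-URD if every proper $\ast$-invertible $\ast$-ideal is, uniquely up to order, a $\ast$-product of finitely many pairwise $\ast$-comaximal $\ast$-packets. $\ast\text{-}\mathrm{Spec}(R)$, the set of $\ast$-primes, is treed if any two incomparable $\ast$-primes are $\ast$-comaximal. $R$ has $\ast$-finite character if each nonzero element of $R$ lies in at most finitely many $\ast$-maximal ideals. $R$ is $\ast$-independent if the intersection of two distinct $\ast$-maximal ideals never contains a $\ast$-prime. A URD is a $t$-URD, and a weakly Matlis domain is a $t$-independent domain of $t$-finite character. Theorem. (1) Let $\ast$ be a star operation of finite type on $R$ such that each $\ast$-prime is contained in a unique $\ast$-maximal ideal. Then the following conditions are equivalent: (i) $\ast\text{-}\mathrm{Spec}(R)$ is treed and $R$ has $\ast$-finite character; (ii) $R$ is a $\ast$-URD; (iii) each proper $\ast$-ideal $I$ is, uniquely up to order, expressible as $I=(Q_1Q_2\cdots Q_n)^\ast$, where the $Q_i$ are pairwise $\ast$-comaximal $\ast$-ideals with prime radical. (2) Let $\ast$ be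 a star operation of finite type on $R$, and assume that $R$ is $\ast$-independent of $\ast$-finite character. Then $R$ is a $\ast$-URD if and only if $\ast\text{-}\mathrm{Spec}(R)$ is treed. (3) In particular, a weakly Matlis domain $R$ is a URD if and only if $t\text{-}\mathrm{Spec}(R)$ is treed. -/

import Mathlib

open scoped nonZeroDivisors

/-- A star operation on the integral domain `R` with quotient field `K`.
The map is written on all fractional ideals, with the zero ideal (which is not an object of the
classical definition) sent to itself; this is the same datum as a map on nonzero fractional
ideals subject to the usual axioms. -/
structure StarOperation (R : Type*) [CommRing R] [IsDomain R] (K : Type*) [Field K] [Algebra R K]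
    [IsFractionRing R K] where
  /-- The closure `I ↦ I^*`. -/
  cl : FractionalIdeal R⁰ K → FractionalIdeal R⁰ K
  cl_zero : cl 0 = 0
  cl_one : cl 1 = 1
  cl_smul : ∀ (a : K), a ≠ 0 → ∀ I : FractionalIdeal R⁰ K,
    cl (FractionalIdeal.spanSingleton R⁰ a * I) = FractionalIdeal.spanSingleton R⁰ a * cl I
  le_cl : ∀ I : FractionalIdeal R⁰ K, I ≤ cl I
  cl_mono : ∀ I J : FractionalIdeal R⁰ K, I ≤ J → cl I ≤ cl J
  cl_cl : ∀ I : FractionalIdeal R⁰ K, cl (cl I) = cl I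

namespace StarOperation

variable {R : Type*} [CommRing R] [IsDomain R] {K : Type*} [Field K] [Algebra R K]
  [IsFractionRing R K]

/-- `*` is of finite type: `I^*` is the union of the `J^*`, `J ⊆ I` nonzero finitely generated. -/
def IsFiniteType (s : StarOperation R K) : Prop :=
  ∀ I : FractionalIdeal R⁰ K, I ≠ 0 → ∀ x : K,
    x ∈ s.cl I ↔ ∃ J : FractionalIdeal R⁰ K,
      J ≠ 0 ∧ J ≤ I ∧ (J : Submodule R K).FG ∧ x ∈ s.cl J

/-- An integral `*`-ideal: a nonzero ideal `I ⊆ R` with `I^* = I`. -/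
def IsStarIdeal (s : StarOperation R K) (I : Ideal R) : Prop :=
  I ≠ ⊥ ∧ s.cl (I : FractionalIdeal R⁰ K) = (I : FractionalIdeal R⁰ K)

/-- A `*`-prime: a prime ideal that is a `*`-ideal. -/
def IsStarPrime (s : StarOperation R K) (P : Ideal R) : Prop :=
  P.IsPrime ∧ s.IsStarIdeal P

/-- A `*`-maximal ideal: maximal in the set of proper integral `*`-ideals. -/
def IsStarMaximal (s : StarOperation R K) (M : Ideal R) : Prop :=
  Maximal (fun I : Ideal R => s.IsStarIdeal I ∧ I ≠ ⊤) M

/-- `I` and `J` are `*`-comaximal: `(I + J)^* = R`. -/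
def Comaximal (s : StarOperation R K) (I J : Ideal R) : Prop :=
  s.cl ((I + J : Ideal R) : FractionalIdeal R⁰ K) = 1

/-- `I` is `*`-invertible: `(I I⁻¹)^* = R`. -/
def IsInvertible (s : StarOperation R K) (I : Ideal R) : Prop :=
  s.cl ((I : FractionalIdeal R⁰ K) * (I : FractionalIdeal R⁰ K)⁻¹) = 1

/-- `I` is the `*`-product of the finite family `m` of ideals: `I = (∏ Q)^*`. -/
def IsStarProduct (s : StarOperation R K) (I : Ideal R) (m : Multiset (Ideal R)) : Prop :=
  (I : FractionalIdeal R⁰ K) = s.cl ((m.prod : Ideal R) : FractionalIdeal R⁰ K)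

/-- `*-Spec(R)` is treed: any two incomparable `*`-primes are `*`-comaximal. -/
def IsTreed (s : StarOperation R K) : Prop :=
  ∀ P Q : Ideal R, s.IsStarPrime P → s.IsStarPrime Q → ¬ P ≤ Q → ¬ Q ≤ P → s.Comaximal P Q

/-- `R` has `*`-finite character. -/
def HasFiniteCharacter (s : StarOperation R K) : Prop :=
  ∀ x : R, x ≠ 0 → {M : Ideal R | s.IsStarMaximal M ∧ x ∈ M}.Finite

/-- `R` is `*`-independent: the intersection of two distinct `*`-maximal ideals contains no
`*`-prime. -/
def IsIndependent (s : StarOperation R K) : Prop :=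
  ∀ M N : Ideal R, s.IsStarMaximal M → s.IsStarMaximal N → M ≠ N →
    ∀ P : Ideal R, s.IsStarPrime P → ¬ P ≤ M ⊓ N

/-- A `*`-packet: a `*`-invertible integral `*`-ideal with a unique minimal prime. -/
def IsPacket (s : StarOperation R K) (I : Ideal R) : Prop :=
  s.IsStarIdeal I ∧ s.IsInvertible I ∧ ∃! P : Ideal R, P ∈ I.minimalPrimes

/-- `R` is a `*`-URD: every proper `*`-invertible `*`-ideal is, uniquely up to order, a
`*`-product of finitely many pairwise `*`-comaximal `*`-packets. -/
def IsURD (s : StarOperation R K) : Prop :=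
  ∀ I : Ideal R, s.IsStarIdeal I → I ≠ ⊤ → s.IsInvertible I →
    ∃! m : Multiset (Ideal R),
      (∀ Q ∈ m, s.IsPacket Q) ∧ m.Pairwise s.Comaximal ∧ s.IsStarProduct I m

section divisorial

variable (R K)

theorem inverse_ne_zero {I : FractionalIdeal R⁰ K} (hI : I ≠ 0) : I⁻¹ ≠ 0 := by
  intro h
  have h1 := FractionalIdeal.isFractional I
  obtain ⟨a, ha, haI⟩ := h1
  have hmem : algebraMap R K a ∈ I⁻¹ := by
    rw [FractionalIdeal.mem_inv_iff hI]
    intro y hy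
    rw [FractionalIdeal.mem_one_iff]
    obtain ⟨r, hr⟩ := haI y hy
    exact ⟨r, by rw [hr, Algebra.smul_def]⟩
  rw [h, FractionalIdeal.mem_zero_iff] at hmem
  exact nonZeroDivisors.ne_zero ha ((IsFractionRing.injective R K) (by simpa using hmem))

theorem le_inverse_inverse (I : FractionalIdeal R⁰ K) : I ≤ I⁻¹⁻¹ := by
  by_cases hI : I = 0
  · subst hI
    exact FractionalIdeal.zero_le _
  · intro x hx
    rw [FractionalIdeal.mem_inv_iff (inverse_ne_zero R K hI)]
    intro y hy
    rw [mul_comm]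
    exact (FractionalIdeal.mem_inv_iff hI).1 hy x hx

theorem inverse_inverse_mono (I J : FractionalIdeal R⁰ K) (h : I ≤ J) : I⁻¹⁻¹ ≤ J⁻¹⁻¹ := by
  by_cases hI : I = 0
  · subst hI
    rw [FractionalIdeal.inv_zero', FractionalIdeal.inv_zero']
    exact FractionalIdeal.zero_le _
  · have hJ : J ≠ 0 := fun hJ => hI (le_antisymm (hJ ▸ h) (FractionalIdeal.zero_le _))
    exact FractionalIdeal.inv_anti_mono (inverse_ne_zero R K hJ) (inverse_ne_zero R K hI)
      (FractionalIdeal.inv_anti_mono hI hJ h)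

theorem inverse_smul (a : K) (ha : a ≠ 0) (I : FractionalIdeal R⁰ K) :
    (FractionalIdeal.spanSingleton R⁰ a * I)⁻¹ = FractionalIdeal.spanSingleton R⁰ a⁻¹ * I⁻¹ := by
  by_cases hI : I = 0
  · subst hI
    rw [mul_zero, FractionalIdeal.inv_zero', mul_zero]
  · have haI : FractionalIdeal.spanSingleton R⁰ a * I ≠ 0 := by
      intro h
      apply hI
      rw [← one_mul I, ← FractionalIdeal.spanSingleton_one, ← inv_mul_cancel₀ ha,
        ← FractionalIdeal.spanSingleton_mul_spanSingleton, mul_assoc, h, mul_zero]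
    ext x
    rw [FractionalIdeal.mem_inv_iff haI, FractionalIdeal.mem_singleton_mul]
    constructor
    · intro h
      refine ⟨a * x, ?_, by field_simp⟩
      rw [FractionalIdeal.mem_inv_iff hI]
      intro y hy
      have := h (a * y) (FractionalIdeal.mem_singleton_mul.2 ⟨y, hy, rfl⟩)
      rwa [show a * x * y = x * (a * y) by ring]
    · rintro ⟨z, hz, rfl⟩ y hy
      obtain ⟨w, hw, rfl⟩ := FractionalIdeal.mem_singleton_mul.1 hy
      have := (FractionalIdeal.mem_inv_iff hI).1 hz w hw
      rwa [show a⁻¹ * z * (a * w) = z * w by field_simp]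

/-- The `v`-operation `I ↦ (I⁻¹)⁻¹`, where `I⁻¹ = (R : I)`. -/
noncomputable def v : StarOperation R K where
  cl I := I⁻¹⁻¹
  cl_zero := by rw [FractionalIdeal.inv_zero', FractionalIdeal.inv_zero']
  cl_one := by rw [inv_one, inv_one]
  cl_smul a ha I := by
    rw [inverse_smul R K a ha, inverse_smul R K a⁻¹ (inv_ne_zero ha), inv_inv]
  le_cl := le_inverse_inverse R K
  cl_mono := inverse_inverse_mono R K
  cl_cl I := by
    by_cases hI : I = 0
    · subst hI
      simp only [FractionalIdeal.inv_zero']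
    · have h1 := inverse_ne_zero R K hI
      have h2 := inverse_ne_zero R K h1
      have h3 := inverse_ne_zero R K h2
      refine le_antisymm ?_ (le_inverse_inverse R K _)
      exact FractionalIdeal.inv_anti_mono h1 h3 (le_inverse_inverse R K _)

end divisorial

/-- The union of the `J^*`, `J` ranging over the finitely generated subideals of `I`. -/
def finiteClosure (s : StarOperation R K) (I : FractionalIdeal R⁰ K) :
    FractionalIdeal R⁰ K :=
  ⟨{ carrier := {x | ∃ J : FractionalIdeal R⁰ K,
        J ≤ I ∧ (J : Submodule R K).FG ∧ x ∈ s.cl J}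
     zero_mem' := ⟨0, FractionalIdeal.zero_le _, by
        rw [FractionalIdeal.coe_zero]; exact Submodule.fg_bot, FractionalIdeal.zero_mem _⟩
     add_mem' := by
        rintro x y ⟨J, hJ, hJf, hx⟩ ⟨L, hL, hLf, hy⟩
        refine ⟨J ⊔ L, sup_le hJ hL, ?_, ?_⟩
        · rw [FractionalIdeal.coe_sup]
          exact hJf.sup hLf
        · exact Submodule.add_mem (s.cl (J ⊔ L) : Submodule R K)
            (s.cl_mono _ _ le_sup_left hx) (s.cl_mono _ _ le_sup_right hy)
     smul_mem' := by
        rintro c x ⟨J, hJ, hJf, hx⟩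
        exact ⟨J, hJ, hJf, Submodule.smul_mem (s.cl J : Submodule R K) c hx⟩ },
    FractionalIdeal.isFractional_of_le (J := s.cl I) (by
      rintro x ⟨J, hJ, -, hx⟩
      exact s.cl_mono _ _ hJ hx)⟩

theorem mem_finiteClosure (s : StarOperation R K) (I : FractionalIdeal R⁰ K) (x : K) :
    x ∈ s.finiteClosure I ↔ ∃ J : FractionalIdeal R⁰ K,
      J ≤ I ∧ (J : Submodule R K).FG ∧ x ∈ s.cl J :=
  Iff.rfl

theorem finiteClosure_le (s : StarOperation R K) (I : FractionalIdeal R⁰ K) :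
    s.finiteClosure I ≤ s.cl I := by
  rintro x ⟨J, hJ, -, hx⟩
  exact s.cl_mono _ _ hJ hx

theorem spanSingleton_fg (x : K) :
    ((FractionalIdeal.spanSingleton R⁰ x : FractionalIdeal R⁰ K) : Submodule R K).FG := by
  rw [FractionalIdeal.coe_spanSingleton]
  exact Submodule.fg_span_singleton x

theorem le_finiteClosure (s : StarOperation R K) (I : FractionalIdeal R⁰ K) :
    I ≤ s.finiteClosure I := by
  intro x hx
  refine (s.mem_finiteClosure I x).2 ⟨FractionalIdeal.spanSingleton R⁰ x,
    FractionalIdeal.spanSingleton_le_iff_mem.2 hx, spanSingleton_fg x, ?_⟩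
  exact s.le_cl _ (FractionalIdeal.mem_spanSingleton_self _ x)

theorem finiteClosure_smul_le (s : StarOperation R K) (a : K) (ha : a ≠ 0)
    (I : FractionalIdeal R⁰ K) :
    FractionalIdeal.spanSingleton R⁰ a * s.finiteClosure I ≤
      s.finiteClosure (FractionalIdeal.spanSingleton R⁰ a * I) := by
  intro x hx
  obtain ⟨y, ⟨J, hJ, hJf, hy⟩, rfl⟩ := FractionalIdeal.mem_singleton_mul.1 hx
  refine ⟨FractionalIdeal.spanSingleton R⁰ a * J, mul_le_mul_right hJ _, ?_, ?_⟩
  · rw [FractionalIdeal.coe_mul]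
    exact (spanSingleton_fg a).mul hJf
  · rw [s.cl_smul a ha]
    exact FractionalIdeal.mem_singleton_mul.2 ⟨y, hy, rfl⟩

/-- A finitely generated subideal of `finiteClosure I` lies in `J^*` for a single finitely
generated `J ⊆ I`. -/
theorem exists_fg_of_le_finiteClosure (s : StarOperation R K) (I : FractionalIdeal R⁰ K)
    (L : Submodule R K) (hL : L.FG) (hLI : L ≤ (s.finiteClosure I : Submodule R K)) :
    ∃ J : FractionalIdeal R⁰ K, J ≤ I ∧ (J : Submodule R K).FG ∧
      L ≤ (s.cl J : Submodule R K) := by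
  induction L, hL using Submodule.fg_induction with
  | singleton x =>
    obtain ⟨J, hJ, hJf, hx⟩ := hLI (Submodule.mem_span_singleton_self x)
    exact ⟨J, hJ, hJf, (Submodule.span_singleton_le_iff_mem _ _).2 hx⟩
  | sup M N _ _ hM hN =>
    obtain ⟨J, hJ, hJf, hx⟩ := hM (le_sup_left.trans hLI)
    obtain ⟨J', hJ', hJf', hx'⟩ := hN (le_sup_right.trans hLI)
    refine ⟨J ⊔ J', sup_le hJ hJ', ?_, sup_le ?_ ?_⟩
    · rw [FractionalIdeal.coe_sup]
      exact hJf.sup hJf'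
    · exact hx.trans (s.cl_mono _ _ le_sup_left)
    · exact hx'.trans (s.cl_mono _ _ le_sup_right)

/-- The star operation of finite type `*_f` associated to `*`. -/
def finite (s : StarOperation R K) : StarOperation R K where
  cl := s.finiteClosure
  cl_zero := le_antisymm ((s.finiteClosure_le 0).trans s.cl_zero.le) (FractionalIdeal.zero_le _)
  cl_one := le_antisymm ((s.finiteClosure_le 1).trans s.cl_one.le) (s.le_finiteClosure 1)
  cl_smul a ha I := by
    refine le_antisymm ?_ (s.finiteClosure_smul_le a ha I)
    have h := mul_le_mul_right
      (s.finiteClosure_smul_le a⁻¹ (inv_ne_zero ha) (FractionalIdeal.spanSingleton R⁰ a * I))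
      (FractionalIdeal.spanSingleton R⁰ a)
    have h1 : ∀ L : FractionalIdeal R⁰ K, FractionalIdeal.spanSingleton R⁰ a *
        (FractionalIdeal.spanSingleton R⁰ a⁻¹ * L) = L := fun L => by
      rw [← mul_assoc, FractionalIdeal.spanSingleton_mul_spanSingleton, mul_inv_cancel₀ ha,
        FractionalIdeal.spanSingleton_one, one_mul]
    have h2 : FractionalIdeal.spanSingleton R⁰ a⁻¹ *
        (FractionalIdeal.spanSingleton R⁰ a * I) = I := by
      rw [← mul_assoc, FractionalIdeal.spanSingleton_mul_spanSingleton, inv_mul_cancel₀ ha,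
        FractionalIdeal.spanSingleton_one, one_mul]
    rwa [h1, h2] at h
  le_cl := s.le_finiteClosure
  cl_mono I J hIJ := by
    rintro x ⟨L, hL, hLf, hx⟩
    exact ⟨L, hL.trans hIJ, hLf, hx⟩
  cl_cl I := by
    refine le_antisymm ?_ (s.le_finiteClosure _)
    rintro x ⟨L, hL, hLf, hx⟩
    obtain ⟨J, hJ, hJf, hLJ⟩ := s.exists_fg_of_le_finiteClosure I L hLf hL
    refine ⟨J, hJ, hJf, ?_⟩
    have h := s.cl_mono L (s.cl J) hLJ hx
    rwa [s.cl_cl] at h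

variable (R K) in
/-- The `t`-operation, the star operation of finite type associated to the `v`-operation. -/
noncomputable def t : StarOperation R K := (v R K).finite

end StarOperation

/-- `R`, with quotient field `K`, is a weakly Matlis domain: `t`-independent of `t`-finite
character. -/
def IsWeaklyMatlis (R : Type*) [CommRing R] [IsDomain R] (K : Type*) [Field K] [Algebra R K]
    [IsFractionRing R K] : Prop :=
  (StarOperation.t R K).IsIndependent ∧ (StarOperation.t R K).HasFiniteCharacter

/-! The proof is local at the `*`-maximal ideals. For a prime `M`, `component I M` is `IR_M ∩ R`. In
finite type, every proper `*`-ideal lies in a `*`-maximal ideal, `*`-maximal ideals are prime, and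
membership in a `*`-ideal can be tested at them (`mem_of_forall_isStarMaximal`).

Uniqueness: the radical of a factor `Q` of `I` is a `*`-prime, so `Q` lies in exactly one
`*`-maximal `M`. The other factors are comaximal to `Q`, hence escape `M`, and `Q = component I M`
(`eq_component_of_mem`). The factors are thus determined by `I`.

Existence: finite character leaves finitely many `M ⊇ I`, treedness leaves one minimal prime of `I`
under each, so the components have prime radical, and their `*`-product agrees with `I` locally.

Conversely, representations of principal ideals suffice. The factors of `xR` correspond to the
`*`-maximal ideals containing `x`, which are thus finite in number. If incomparable `P, Q` lie in
`M`, with `a ∈ P \ Q` and `b ∈ Q \ P`, the factor of `abR` inside `M` has prime radical contained in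
`P ∩ Q` yet containing `a` or `b`, which is absurd. -/

namespace StarOperation

/-! ### Components of an ideal at a prime -/

section component

variable {R : Type*} [CommRing R]

/-- The contraction to `R` of the localization of `I` at the prime `M`. -/
def component (I M : Ideal R) : Ideal R :=
  Ideal.span {x | ∃ y ∉ M, y * x ∈ I}

theorem mem_component {I M : Ideal R} (hM : M.IsPrime) {x : R} :
    x ∈ component I M ↔ ∃ y ∉ M, y * x ∈ I := by
  refine ⟨fun hx => ?_, fun hx => Ideal.subset_span hx⟩
  induction hx using Submodule.span_induction with
  | mem x hx => exact hx
  | zero => exact ⟨1, (Ideal.ne_top_iff_one M).1 hM.ne_top, by simp⟩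
  | add a b _ _ ha hb =>
    obtain ⟨y, hy, hya⟩ := ha
    obtain ⟨z, hz, hzb⟩ := hb
    refine ⟨y * z, fun h => (hM.mem_or_mem h).elim hy hz, ?_⟩
    rw [show y * z * (a + b) = z * (y * a) + y * (z * b) by ring]
    exact I.add_mem (I.mul_mem_left _ hya) (I.mul_mem_left _ hzb)
  | smul r a _ ha =>
    obtain ⟨y, hy, hya⟩ := ha
    refine ⟨y, hy, ?_⟩
    rw [smul_eq_mul, mul_left_comm]
    exact I.mul_mem_left _ hya

theorem le_component (I : Ideal R) {M : Ideal R} (hM : M.IsPrime) : I ≤ component I M :=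
  fun x hx => (mem_component hM).2 ⟨1, (Ideal.ne_top_iff_one M).1 hM.ne_top, by rwa [one_mul]⟩

theorem component_le {I M P : Ideal R} (hM : M.IsPrime) (hP : P.IsPrime) (hIP : I ≤ P)
    (hPM : P ≤ M) : component I M ≤ P := fun x hx => by
  obtain ⟨y, hy, hyx⟩ := (mem_component hM).1 hx
  exact (hP.mem_or_mem (hIP hyx)).resolve_left fun h => hy (hPM h)

/-- Primes of `R_M` are handled without localizing: if `x` is not in the radical, `I` avoids the
multiplicative set generated by `R \ M` and `x`, and so does some prime over `I`. -/
theorem exists_mem_minimalPrimes_of_notMem_radical_component {I M : Ideal R} (hM : M.IsPrime)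
    {x : R} (hx : x ∉ (component I M).radical) : ∃ P ∈ I.minimalPrimes, P ≤ M ∧ x ∉ P := by
  have hd : Disjoint (I : Set R) (M.primeCompl ⊔ Submonoid.powers x : Submonoid R) := by
    rw [Set.disjoint_left]
    intro z hz hz'
    obtain ⟨y, hy, w, ⟨n, rfl⟩, rfl⟩ := Submonoid.mem_sup.1 hz'
    exact hx ⟨n, (mem_component hM).2 ⟨y, hy, hz⟩⟩
  obtain ⟨q, hq, hIq, hqd⟩ := Ideal.exists_le_prime_disjoint _ _ hd
  rw [Set.disjoint_left] at hqd
  obtain ⟨P, hP, hPq⟩ := Ideal.exists_minimalPrimes_le hIq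
  refine ⟨P, hP, fun y hy => ?_, fun h => ?_⟩
  · by_contra hyM
    exact hqd (hPq hy) (Submonoid.mem_sup_left hyM)
  · exact hqd (hPq h) (Submonoid.mem_sup_right (Submonoid.mem_powers x))

theorem radical_component_eq {I M P : Ideal R} (hM : M.IsPrime) (hP : P ∈ I.minimalPrimes)
    (hPM : P ≤ M) (h : ∀ P' ∈ I.minimalPrimes, P' ≤ M → P' = P) :
    (component I M).radical = P := by
  refine le_antisymm ?_ fun x hx => ?_
  · exact (hP.1.1.radical_le_iff).2 (component_le hM hP.1.1 hP.1.2 hPM)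
  · by_contra hx'
    obtain ⟨P', hP', hPM', hxP'⟩ := exists_mem_minimalPrimes_of_notMem_radical_component hM hx'
    exact hxP' (h P' hP' hPM' ▸ hx)

/-- Reconciles packets with the ideals of prime radical in (iii). -/
theorem existsUnique_minimalPrimes_iff {I : Ideal R} :
    (∃! P : Ideal R, P ∈ I.minimalPrimes) ↔ I.radical.IsPrime := by
  constructor
  · rintro ⟨P, hP, hu⟩
    have h : I.minimalPrimes = {P} := Set.eq_singleton_iff_unique_mem.2 ⟨hP, hu⟩
    rw [← Ideal.sInf_minimalPrimes, h, sInf_singleton]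
    exact hP.1.1
  · intro h
    rw [← Ideal.radical_minimalPrimes, Ideal.minimalPrimes_eq_subsingleton_self]
    exact ⟨_, rfl, fun _ h => h⟩

end component

/-! ### Star closure of integral ideals -/

variable {R : Type*} [CommRing R] [IsDomain R] {K : Type*} [Field K] [Algebra R K]
  [IsFractionRing R K]

/-- Homogeneity handles each nonzero `j ∈ B`: `j A^* = (jA)^* ⊆ (AB)^*`. -/
theorem cl_mul_le (s : StarOperation R K) (A B : FractionalIdeal R⁰ K) :
    s.cl A * B ≤ s.cl (A * B) := by
  rw [FractionalIdeal.mul_le]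
  intro i hi j hj
  by_cases h : j = 0
  · subst h
    rw [mul_zero]
    exact FractionalIdeal.zero_mem _
  · have h1 : FractionalIdeal.spanSingleton R⁰ j * A ≤ A * B := by
      rw [mul_comm]
      exact mul_le_mul_right (FractionalIdeal.spanSingleton_le_iff_mem.2 hj) _
    apply s.cl_mono _ _ h1
    rw [s.cl_smul j h, mul_comm i j]
    exact FractionalIdeal.mem_singleton_mul.2 ⟨i, hi, rfl⟩

/-- The closure `I ↦ I^*` on integral ideals. -/
def clIdeal (s : StarOperation R K) (I : Ideal R) : Ideal R :=
  (s.cl (I : FractionalIdeal R⁰ K) : Submodule R K).comap (Algebra.linearMap R K)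

theorem cl_le_one (s : StarOperation R K) {A : FractionalIdeal R⁰ K} (hA : A ≤ 1) :
    s.cl A ≤ 1 :=
  (s.cl_mono _ _ hA).trans s.cl_one.le

theorem coe_clIdeal (s : StarOperation R K) (I : Ideal R) :
    (s.clIdeal I : FractionalIdeal R⁰ K) = s.cl (I : FractionalIdeal R⁰ K) := by
  ext x
  rw [FractionalIdeal.mem_coeIdeal]
  constructor
  · rintro ⟨y, hy, rfl⟩
    exact hy
  · intro hx
    obtain ⟨y, rfl⟩ := FractionalIdeal.mem_one_iff _ |>.1
      (s.cl_le_one FractionalIdeal.coeIdeal_le_one hx)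
    exact ⟨y, hx, rfl⟩

theorem clIdeal_eq_iff (s : StarOperation R K) {I J : Ideal R} :
    s.clIdeal I = J ↔ s.cl (I : FractionalIdeal R⁰ K) = (J : FractionalIdeal R⁰ K) := by
  rw [← coe_clIdeal, FractionalIdeal.coeIdeal_inj]

theorem isStarIdeal_iff (s : StarOperation R K) {I : Ideal R} :
    s.IsStarIdeal I ↔ I ≠ ⊥ ∧ s.clIdeal I = I := by
  rw [IsStarIdeal, clIdeal_eq_iff]

theorem comaximal_iff (s : StarOperation R K) {I J : Ideal R} :
    s.Comaximal I J ↔ s.clIdeal (I ⊔ J) = ⊤ := by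
  rw [Comaximal, clIdeal_eq_iff, FractionalIdeal.coeIdeal_top, Submodule.add_eq_sup]

theorem isStarProduct_iff (s : StarOperation R K) {I : Ideal R} {m : Multiset (Ideal R)} :
    s.IsStarProduct I m ↔ s.clIdeal m.prod = I := by
  rw [IsStarProduct, clIdeal_eq_iff, eq_comm]

theorem le_clIdeal (s : StarOperation R K) (I : Ideal R) : I ≤ s.clIdeal I := fun _ hx =>
  s.le_cl _ (FractionalIdeal.mem_coeIdeal_of_mem _ hx)

theorem clIdeal_mono (s : StarOperation R K) {I J : Ideal R} (h : I ≤ J) :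
    s.clIdeal I ≤ s.clIdeal J := fun _ hx =>
  s.cl_mono _ _ ((FractionalIdeal.coeIdeal_le_coeIdeal K).2 h) hx

theorem clIdeal_clIdeal (s : StarOperation R K) (I : Ideal R) :
    s.clIdeal (s.clIdeal I) = s.clIdeal I := by
  rw [clIdeal_eq_iff, coe_clIdeal, s.cl_cl]

theorem clIdeal_mul_le (s : StarOperation R K) (I J : Ideal R) :
    s.clIdeal I * J ≤ s.clIdeal (I * J) := by
  rw [← FractionalIdeal.coeIdeal_le_coeIdeal K, FractionalIdeal.coeIdeal_mul, coe_clIdeal,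
    coe_clIdeal, FractionalIdeal.coeIdeal_mul]
  exact s.cl_mul_le _ _

theorem clIdeal_pow_le (s : StarOperation R K) (I : Ideal R) (n : ℕ) :
    s.clIdeal I ^ n ≤ s.clIdeal (I ^ n) := by
  induction n with
  | zero => simpa using s.le_clIdeal 1
  | succ n ih =>
    calc s.clIdeal I ^ (n + 1) = s.clIdeal I ^ n * s.clIdeal I := pow_succ _ _
      _ ≤ s.clIdeal (I ^ n) * s.clIdeal I := Ideal.mul_mono_left ih
      _ ≤ s.clIdeal (I ^ n * s.clIdeal I) := s.clIdeal_mul_le _ _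
      _ ≤ s.clIdeal (s.clIdeal (I ^ (n + 1))) := s.clIdeal_mono (by
          rw [mul_comm, pow_succ']
          exact s.clIdeal_mul_le _ _)
      _ = _ := s.clIdeal_clIdeal _

variable {s : StarOperation R K}

theorem IsStarIdeal.clIdeal_eq {I : Ideal R} (hI : s.IsStarIdeal I) : s.clIdeal I = I :=
  (s.isStarIdeal_iff.1 hI).2

theorem IsStarIdeal.clIdeal_le {I J : Ideal R} (hI : s.IsStarIdeal I) (h : J ≤ I) :
    s.clIdeal J ≤ I :=
  (s.clIdeal_mono h).trans hI.clIdeal_eq.le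

theorem isStarIdeal_clIdeal {I : Ideal R} (hI : I ≠ ⊥) : s.IsStarIdeal (s.clIdeal I) :=
  s.isStarIdeal_iff.2 ⟨fun h => hI (le_bot_iff.1 (h ▸ s.le_clIdeal I)), s.clIdeal_clIdeal I⟩

/-- Colon ideals `(I : x)` of a `*`-ideal are closed under `*`. Used with `A^* = R` and `a = 1` to
conclude `x ∈ I`. -/
theorem IsStarIdeal.mul_mem_of_mem_clIdeal {I A : Ideal R} (hI : s.IsStarIdeal I) {x : R}
    (h : ∀ a ∈ A, a * x ∈ I) {a : R} (ha : a ∈ s.clIdeal A) : a * x ∈ I := by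
  have h1 : A * Ideal.span {x} ≤ I := by
    rw [Ideal.mul_le]
    intro a ha y hy
    obtain ⟨z, rfl⟩ := Ideal.mem_span_singleton'.1 hy
    rw [mul_left_comm]
    exact I.mul_mem_left _ (h a ha)
  exact hI.clIdeal_le h1 (s.clIdeal_mul_le _ _
    (Ideal.mul_mem_mul ha (Ideal.mem_span_singleton_self x)))

theorem isStarIdeal_span_singleton {x : R} (hx : x ≠ 0) : s.IsStarIdeal (Ideal.span {x}) := by
  have hx' : algebraMap R K x ≠ 0 := by simpa using hx
  refine ⟨by simpa using hx, ?_⟩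
  have h := s.cl_smul (algebraMap R K x) hx' 1
  rw [s.cl_one, mul_one] at h
  rwa [FractionalIdeal.coeIdeal_span_singleton]

theorem isInvertible_span_singleton {x : R} (hx : x ≠ 0) : s.IsInvertible (Ideal.span {x}) := by
  have hx' : algebraMap R K x ≠ 0 := by simpa using hx
  rw [IsInvertible, FractionalIdeal.coeIdeal_span_singleton, FractionalIdeal.spanSingleton_inv,
    FractionalIdeal.spanSingleton_mul_spanSingleton, mul_inv_cancel₀ hx',
    FractionalIdeal.spanSingleton_one, s.cl_one]

/-- A factor of a `*`-invertible ideal in a `*`-product is `*`-invertible. -/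
theorem IsInvertible.of_clIdeal_mul_eq {I Q J : Ideal R} (hI : s.IsInvertible I) (h0 : I ≠ ⊥)
    (hQ : Q ≠ ⊥) (h : s.clIdeal (Q * J) = I) : s.IsInvertible Q := by
  have h0' : (I : FractionalIdeal R⁰ K) ≠ 0 := by simpa using h0
  have hQ' : (Q : FractionalIdeal R⁰ K) ≠ 0 := by simpa using hQ
  rw [clIdeal_eq_iff, FractionalIdeal.coeIdeal_mul] at h
  have hle : ∀ A : FractionalIdeal R⁰ K, A ≠ 0 → A * A⁻¹ ≤ 1 := fun A hA => by
    rw [FractionalIdeal.mul_le]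
    intro a ha b hb
    rw [mul_comm]
    exact (FractionalIdeal.mem_inv_iff hA).1 hb a ha
  refine le_antisymm (s.cl_le_one (hle _ hQ')) ?_
  -- Since `QJ ⊆ I`, the ideal `J I⁻¹` sends `Q` into `I I⁻¹ ⊆ R`.
  have h1 : (J : FractionalIdeal R⁰ K) * (I : FractionalIdeal R⁰ K)⁻¹ ≤
      (Q : FractionalIdeal R⁰ K)⁻¹ := by
    intro y hy
    rw [FractionalIdeal.mem_inv_iff hQ']
    intro q hq
    apply hle _ h0'
    have h2 := FractionalIdeal.mul_mem_mul hq hy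
    rw [← mul_assoc] at h2
    rw [mul_comm y q]
    have h3 : (Q : FractionalIdeal R⁰ K) * J ≤ I := h ▸ s.le_cl _
    have h4 := mul_le_mul_left h3 (I : FractionalIdeal R⁰ K)⁻¹
    exact h4 h2
  calc (1 : FractionalIdeal R⁰ K) = s.cl (I * (I : FractionalIdeal R⁰ K)⁻¹) := hI.symm
    _ = s.cl (s.cl (Q * J) * (I : FractionalIdeal R⁰ K)⁻¹) := by rw [h]
    _ ≤ s.cl (s.cl (Q * J * (I : FractionalIdeal R⁰ K)⁻¹)) := s.cl_mono _ _ (s.cl_mul_le _ _)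
    _ = s.cl (Q * (J * (I : FractionalIdeal R⁰ K)⁻¹)) := by rw [s.cl_cl, mul_assoc]
    _ ≤ _ := s.cl_mono _ _ (mul_le_mul_right h1 _)

/-! ### Finite type and `*`-maximal ideals -/

theorem IsFiniteType.exists_fg (hs : s.IsFiniteType) {I : Ideal R} (hI : I ≠ ⊥) {x : R}
    (hx : x ∈ s.clIdeal I) : ∃ J ≤ I, J.FG ∧ x ∈ s.clIdeal J := by
  obtain ⟨J, -, hJI, hJ, hxJ⟩ := (hs I (by simpa using hI) _).1 hx
  obtain ⟨J, rfl⟩ := FractionalIdeal.le_one_iff_exists_coeIdeal.1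
    (hJI.trans FractionalIdeal.coeIdeal_le_one)
  exact ⟨J, (FractionalIdeal.coeIdeal_le_coeIdeal K).1 hJI,
    (FractionalIdeal.coeIdeal_fg R⁰ (IsFractionRing.injective R K) J).1 hJ, hxJ⟩

theorem IsFiniteType.isStarIdeal (hs : s.IsFiniteType) {I : Ideal R} (hI : I ≠ ⊥)
    (h : ∀ J : Ideal R, J.FG → J ≤ I → s.clIdeal J ≤ I) : s.IsStarIdeal I := by
  refine s.isStarIdeal_iff.2 ⟨hI, le_antisymm (fun x hx => ?_) (s.le_clIdeal I)⟩
  obtain ⟨J, hJI, hJ, hx⟩ := hs.exists_fg hI hx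
  exact h J hJ hJI hx

theorem IsFiniteType.exists_isStarMaximal (hs : s.IsFiniteType) {I : Ideal R}
    (hI : s.IsStarIdeal I) (h : I ≠ ⊤) : ∃ M, s.IsStarMaximal M ∧ I ≤ M := by
  suffices hz : ∀ c ⊆ {I : Ideal R | s.IsStarIdeal I ∧ I ≠ ⊤}, IsChain (· ≤ ·) c → ∀ y ∈ c,
      ∃ ub ∈ {I : Ideal R | s.IsStarIdeal I ∧ I ≠ ⊤}, ∀ z ∈ c, z ≤ ub by
    obtain ⟨M, hIM, hM⟩ := zorn_le_nonempty₀ _ hz I ⟨hI, h⟩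
    exact ⟨M, hM, hIM⟩
  intro c hc hchain J hJ
  have hdir : DirectedOn (· ≤ ·) c := hchain.directedOn
  refine ⟨sSup c, ⟨hs.isStarIdeal ?_ fun A hA hAc => ?_, ?_⟩, fun z hz => le_sSup hz⟩
  · exact fun h0 => (hc hJ).1.1 (le_bot_iff.1 (h0 ▸ le_sSup hJ))
  -- A finitely generated ideal inside the union of a chain lies in one member, so finite type makes
  -- the union a `*`-ideal.
  · obtain ⟨B, hB, hAB⟩ := (CompleteLattice.isCompactElement_iff_le_of_directed_sSup_le _ _).1
      ((Submodule.fg_iff_compact A).1 hA) c ⟨J, hJ⟩ hdir hAc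
    exact ((hc hB).1.clIdeal_le hAB).trans (le_sSup hB)
  · rw [Ne, Ideal.eq_top_iff_one, Submodule.mem_sSup_of_directed ⟨J, hJ⟩ hdir]
    rintro ⟨B, hB, h1⟩
    exact (hc hB).2 ((Ideal.eq_top_iff_one B).2 h1)

theorem IsFiniteType.clIdeal_eq_top (hs : s.IsFiniteType) {A : Ideal R} (hA : A ≠ ⊥)
    (h : ∀ M, s.IsStarMaximal M → ¬ A ≤ M) : s.clIdeal A = ⊤ := by
  by_contra h1
  obtain ⟨M, hM, hAM⟩ := hs.exists_isStarMaximal (isStarIdeal_clIdeal hA) h1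
  exact h M hM ((s.le_clIdeal A).trans hAM)

theorem IsStarMaximal.not_comaximal {M I J : Ideal R} (hM : s.IsStarMaximal M) (hI : I ≤ M)
    (hJ : J ≤ M) : ¬ s.Comaximal I J := by
  rw [comaximal_iff]
  intro h
  exact hM.prop.2 (top_le_iff.1 (h ▸ hM.prop.1.clIdeal_le (sup_le hI hJ)))

theorem IsFiniteType.comaximal (hs : s.IsFiniteType) {I J : Ideal R} (hI : I ≠ ⊥)
    (h : ∀ M, s.IsStarMaximal M → I ≤ M → ¬ J ≤ M) : s.Comaximal I J := by
  rw [comaximal_iff]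
  refine hs.clIdeal_eq_top (fun h0 => hI (le_bot_iff.1 (h0 ▸ le_sup_left))) fun M hM hle => ?_
  exact h M hM (le_sup_left.trans hle) (le_sup_right.trans hle)

theorem Comaximal.symm {I J : Ideal R} (h : s.Comaximal I J) : s.Comaximal J I := by
  rw [comaximal_iff] at h ⊢
  rwa [sup_comm]

/-- If `a ∉ M`, maximality gives `(M + aR)^* = R`; as `b` multiplies `M + aR` into `M`, it
multiplies `1` into `M`. -/
theorem IsStarMaximal.isPrime {M : Ideal R} (hM : s.IsStarMaximal M) : M.IsPrime := by
  refine Ideal.isPrime_iff.2 ⟨hM.prop.2, fun {a b} hab => or_iff_not_imp_left.2 fun ha => ?_⟩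
  have h1 : s.clIdeal (M ⊔ Ideal.span {a}) = ⊤ := by
    by_contra h
    have hlt : M < M ⊔ Ideal.span {a} := by
      refine lt_of_le_of_ne le_sup_left fun h => ha ?_
      rw [h]
      exact Ideal.mem_sup_right (Ideal.mem_span_singleton_self a)
    have h0 : M ⊔ Ideal.span {a} ≠ ⊥ := (bot_lt_iff_ne_bot.2 hM.prop.1.1 |>.trans hlt).ne'
    exact (hlt.trans_le (s.le_clIdeal _)).not_ge
      (hM.le_of_ge ⟨isStarIdeal_clIdeal h0, h⟩ (hlt.le.trans (s.le_clIdeal _)))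
  have h2 := hM.prop.1.mul_mem_of_mem_clIdeal (A := M ⊔ Ideal.span {a}) (x := b)
    (a := 1) (fun c hc => ?_) (by rw [h1]; trivial)
  · rwa [one_mul] at h2
  · obtain ⟨m, hm, z, hz, rfl⟩ := Submodule.mem_sup.1 hc
    obtain ⟨w, rfl⟩ := Ideal.mem_span_singleton'.1 hz
    rw [add_mul]
    refine M.add_mem (M.mul_mem_right _ hm) ?_
    rw [mul_assoc]
    exact M.mul_mem_left _ hab

/-- Membership in a `*`-ideal can be tested at the `*`-maximal ideals. -/
theorem IsFiniteType.mem_of_forall_isStarMaximal (hs : s.IsFiniteType) {I : Ideal R}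
    (hI : s.IsStarIdeal I) {x : R} (h : ∀ M, s.IsStarMaximal M → ∃ y ∉ M, y * x ∈ I) :
    x ∈ I := by
  have hle : I ≤ Submodule.comap (LinearMap.mulRight R x) I := fun y hy => I.mul_mem_right _ hy
  have h1 : s.clIdeal (Submodule.comap (LinearMap.mulRight R x) I : Ideal R) = ⊤ := by
    refine hs.clIdeal_eq_top (fun h0 => hI.1 (le_bot_iff.1 (h0 ▸ hle))) fun M hM hAM => ?_
    obtain ⟨y, hy, hyx⟩ := h M hM
    exact hy (hAM hyx)
  have h2 := hI.mul_mem_of_mem_clIdeal (A := Submodule.comap (LinearMap.mulRight R x) I) (x := x)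
    (a := 1) (fun c hc => hc) (by rw [h1]; trivial)
  rwa [one_mul] at h2

theorem finite_isFiniteType (s : StarOperation R K) : s.finite.IsFiniteType := by
  intro I hI x
  constructor
  · rintro ⟨J, hJI, hJ, hx⟩
    -- `finiteClosure` allows `J = 0`, the definition of finite type does not; then `x = 0` and any
    -- nonzero principal subideal serves.
    by_cases h0 : J = 0
    · subst h0
      rw [s.cl_zero, FractionalIdeal.mem_zero_iff] at hx
      subst hx
      obtain ⟨y, hy, hy0⟩ := FractionalIdeal.exists_ne_zero_mem_isInteger hI
      exact ⟨FractionalIdeal.spanSingleton R⁰ (algebraMap R K y),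
        FractionalIdeal.spanSingleton_ne_zero_iff.2 (by simpa using hy),
        FractionalIdeal.spanSingleton_le_iff_mem.2 hy0, spanSingleton_fg _,
        FractionalIdeal.zero_mem _⟩
    · exact ⟨J, h0, hJI, hJ, J, le_rfl, hJ, hx⟩
  · rintro ⟨J, -, hJI, -, hx⟩
    exact s.finite.cl_mono _ _ hJI hx

/-! ### Components, radicals and minimal primes of `*`-ideals -/

theorem IsFiniteType.isStarIdeal_component (hs : s.IsFiniteType) {I M : Ideal R}
    (hI : s.IsStarIdeal I) (hM : M.IsPrime) : s.IsStarIdeal (component I M) := by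
  -- One common denominator `y ∉ M` works for a finitely generated `J`.
  have hfg : ∀ J : Ideal R, J.FG → J ≤ component I M → ∃ y ∉ M, ∀ a ∈ J, a * y ∈ I := by
    intro J hJ
    induction J, hJ using Submodule.fg_induction with
    | singleton x =>
      intro hx
      obtain ⟨y, hy, hyx⟩ := (mem_component hM).1 (hx (Submodule.mem_span_singleton_self x))
      refine ⟨y, hy, fun a ha => ?_⟩
      obtain ⟨z, rfl⟩ := Submodule.mem_span_singleton.1 ha
      rw [smul_eq_mul, mul_assoc, mul_comm x]
      exact I.mul_mem_left _ hyx
    | sup A B _ _ hA hB =>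
      intro h
      obtain ⟨y, hy, hyA⟩ := hA (le_sup_left.trans h)
      obtain ⟨z, hz, hzB⟩ := hB (le_sup_right.trans h)
      refine ⟨y * z, fun h => (hM.mem_or_mem h).elim hy hz, fun c hc => ?_⟩
      obtain ⟨a, ha, b, hb, rfl⟩ := Submodule.mem_sup.1 hc
      rw [show (a + b) * (y * z) = z * (a * y) + y * (b * z) by ring]
      exact I.add_mem (I.mul_mem_left _ (hyA a ha)) (I.mul_mem_left _ (hzB b hb))
  refine hs.isStarIdeal (fun h0 => hI.1 (le_bot_iff.1 (h0 ▸ le_component I hM))) ?_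
  intro J hJ hle a ha
  obtain ⟨y, hy, h⟩ := hfg J hJ hle
  exact (mem_component hM).2 ⟨y, hy, mul_comm a y ▸ hI.mul_mem_of_mem_clIdeal h ha⟩

theorem IsFiniteType.isStarIdeal_radical (hs : s.IsFiniteType) {I : Ideal R}
    (hI : s.IsStarIdeal I) : s.IsStarIdeal I.radical := by
  refine hs.isStarIdeal (fun h0 => hI.1 (le_bot_iff.1 (h0 ▸ Ideal.le_radical))) ?_
  intro J hJ hle a ha
  obtain ⟨n, hn⟩ := Ideal.exists_pow_le_of_le_radical_of_fg hle hJ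
  exact ⟨n, hI.clIdeal_le hn (s.clIdeal_pow_le J n (Ideal.pow_mem_pow ha n))⟩

theorem IsFiniteType.isStarPrime_of_mem_minimalPrimes (hs : s.IsFiniteType) {I P : Ideal R}
    (hI : s.IsStarIdeal I) (hP : P ∈ I.minimalPrimes) : s.IsStarPrime P := by
  refine ⟨hP.1.1, ?_⟩
  -- `P` is the radical of the component of `I` at `P` itself.
  rw [← radical_component_eq hP.1.1 hP le_rfl fun P' hP' h => le_antisymm h (hP.2 hP'.1 h)]
  exact hs.isStarIdeal_radical (hs.isStarIdeal_component hI hP.1.1)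

/-! ### Rigidity of representations -/

/-- `I` is the `*`-product of the pairwise `*`-comaximal `*`-ideals in `m`, all of which have
prime radical. -/
def IsRepresentation (s : StarOperation R K) (I : Ideal R) (m : Multiset (Ideal R)) : Prop :=
  (∀ Q ∈ m, s.IsStarIdeal Q ∧ Q.radical.IsPrime) ∧ m.Pairwise s.Comaximal ∧ s.IsStarProduct I m

/-- Each `*`-prime is contained in a unique `*`-maximal ideal. -/
def UniqueStarMaximal (s : StarOperation R K) : Prop :=
  ∀ P : Ideal R, s.IsStarPrime P → ∃! M : Ideal R, s.IsStarMaximal M ∧ P ≤ M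

/-- `Multiset.Pairwise` refers to some enumeration; symmetry makes the choice irrelevant. -/
theorem comaximal_of_pairwise_cons {m : Multiset (Ideal R)} {Q Q' : Ideal R}
    (h : (Q ::ₘ m).Pairwise s.Comaximal) (hQ' : Q' ∈ m) : s.Comaximal Q Q' := by
  have : Std.Symm s.Comaximal := ⟨fun _ _ h => h.symm⟩
  induction m using Quotient.inductionOn with
  | h l =>
    have h' : Multiset.Pairwise s.Comaximal ((Q :: l : List (Ideal R)) : Multiset (Ideal R)) := h
    rw [Multiset.pairwise_coe_iff_pairwise, List.pairwise_cons] at h'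
    exact h'.1 Q' hQ'

theorem IsRepresentation.exists_le {I M : Ideal R} {m : Multiset (Ideal R)}
    (h : s.IsRepresentation I m) (hM : M.IsPrime) (hIM : I ≤ M) : ∃ Q ∈ m, Q ≤ M := by
  rw [← hM.multiset_prod_le]
  refine le_trans ?_ hIM
  rw [← s.isStarProduct_iff.1 h.2.2]
  exact s.le_clIdeal _

theorem IsRepresentation.exists_notMem_mul_mem {I M Q : Ideal R} {m : Multiset (Ideal R)}
    (h : s.IsRepresentation I m) (hM : s.IsStarMaximal M) (hQ : Q ∈ m) (hQM : Q ≤ M) :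
    ∃ y ∉ M, ∀ x ∈ Q, y * x ∈ I := by
  obtain ⟨m', rfl⟩ := Multiset.exists_cons_of_mem hQ
  have h1 : ¬ m'.prod ≤ M := by
    rw [hM.isPrime.multiset_prod_le]
    rintro ⟨Q', hQ', hle⟩
    exact hM.not_comaximal hQM hle (comaximal_of_pairwise_cons h.2.1 hQ')
  obtain ⟨y, hy, hyM⟩ := SetLike.not_le_iff_exists.1 h1
  refine ⟨y, hyM, fun x hx => ?_⟩
  rw [← s.isStarProduct_iff.1 h.2.2, Multiset.prod_cons, mul_comm y]
  exact s.le_clIdeal _ (Ideal.mul_mem_mul hx hy)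

theorem IsRepresentation.le_of_mem {I Q : Ideal R} {m : Multiset (Ideal R)}
    (h : s.IsRepresentation I m) (hQ : Q ∈ m) : I ≤ Q := by
  obtain ⟨m', rfl⟩ := Multiset.exists_cons_of_mem hQ
  rw [← s.isStarProduct_iff.1 h.2.2, Multiset.prod_cons]
  exact (h.1 Q hQ).1.clIdeal_le Ideal.mul_le_left

theorem IsFiniteType.isStarPrime_radical (hs : s.IsFiniteType) {Q : Ideal R}
    (hQ : s.IsStarIdeal Q) (hQr : Q.radical.IsPrime) : s.IsStarPrime Q.radical :=
  ⟨hQr, hs.isStarIdeal_radical hQ⟩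

theorem IsFiniteType.eq_component_of_mem (hs : s.IsFiniteType) (hu : s.UniqueStarMaximal)
    {I M Q : Ideal R} {m : Multiset (Ideal R)} (h : s.IsRepresentation I m)
    (hM : s.IsStarMaximal M) (hQ : Q ∈ m) (hQM : Q ≤ M) : Q = component I M := by
  have hQ1 := h.1 Q hQ
  refine le_antisymm (fun x hx => ?_) fun x hx => ?_
  · obtain ⟨y, hy, h1⟩ := h.exists_notMem_mul_mem hM hQ hQM
    exact (mem_component hM.isPrime).2 ⟨y, hy, h1 x hx⟩
  · obtain ⟨y, hy, hyx⟩ := (mem_component hM.isPrime).1 hx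
    have hrad : ∀ {N : Ideal R}, s.IsStarMaximal N → Q ≤ N → Q.radical ≤ N := fun hN hle =>
      hN.isPrime.radical_le_iff.2 hle
    refine hs.mem_of_forall_isStarMaximal hQ1.1 fun N hN => ?_
    -- If `Q ≤ N`, the `*`-prime `Q.radical` lies in both `M` and `N`, forcing `N = M`; otherwise
    -- `Q` is trivial at `N`.
    by_cases hQN : Q ≤ N
    · have := (hu _ (hs.isStarPrime_radical hQ1.1 hQ1.2)).unique ⟨hN, hrad hN hQN⟩
        ⟨hM, hrad hM hQM⟩
      subst this
      exact ⟨y, hy, h.le_of_mem hQ hyx⟩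
    · obtain ⟨z, hz, hzN⟩ := SetLike.not_le_iff_exists.1 hQN
      exact ⟨z, hzN, Q.mul_mem_right _ hz⟩

theorem IsRepresentation.exists_isStarMaximal (hs : s.IsFiniteType) {I Q : Ideal R}
    {m : Multiset (Ideal R)} (h : s.IsRepresentation I m) (hQ : Q ∈ m) :
    ∃ M, s.IsStarMaximal M ∧ Q ≤ M :=
  hs.exists_isStarMaximal (h.1 Q hQ).1 fun ht => (h.1 Q hQ).2.ne_top (by rw [ht, Ideal.radical_top])

theorem IsFiniteType.mem_iff_of_isRepresentation (hs : s.IsFiniteType)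
    (hu : s.UniqueStarMaximal) {I Q : Ideal R} {m : Multiset (Ideal R)}
    (h : s.IsRepresentation I m) :
    Q ∈ m ↔ ∃ M, s.IsStarMaximal M ∧ I ≤ M ∧ Q = component I M := by
  constructor
  · intro hQ
    obtain ⟨M, hM, hQM⟩ := h.exists_isStarMaximal hs hQ
    exact ⟨M, hM, (h.le_of_mem hQ).trans hQM, hs.eq_component_of_mem hu h hM hQ hQM⟩
  · rintro ⟨M, hM, hIM, rfl⟩
    obtain ⟨Q, hQ, hQM⟩ := h.exists_le hM.isPrime hIM
    rwa [← hs.eq_component_of_mem hu h hM hQ hQM]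

theorem IsRepresentation.nodup (hs : s.IsFiniteType) {I : Ideal R} {m : Multiset (Ideal R)}
    (h : s.IsRepresentation I m) : m.Nodup := by
  rw [Multiset.nodup_iff_ne_cons_cons]
  rintro Q m' rfl
  have hQ : Q ∈ Q ::ₘ m' := Multiset.mem_cons_self Q m'
  obtain ⟨M, hM, hQM⟩ := h.exists_isStarMaximal hs (Multiset.mem_cons_of_mem hQ)
  exact hM.not_comaximal hQM hQM (comaximal_of_pairwise_cons h.2.1 hQ)

theorem IsFiniteType.isRepresentation_unique (hs : s.IsFiniteType) (hu : s.UniqueStarMaximal)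
    {I : Ideal R} {m m' : Multiset (Ideal R)} (h : s.IsRepresentation I m)
    (h' : s.IsRepresentation I m') : m = m' :=
  (Multiset.Nodup.ext (h.nodup hs) (h'.nodup hs)).2 fun _ =>
    (hs.mem_iff_of_isRepresentation hu h).trans (hs.mem_iff_of_isRepresentation hu h').symm

/-! ### Existence of representations -/

theorem HasFiniteCharacter.finite_le (hf : s.HasFiniteCharacter) {I : Ideal R} (hI : I ≠ ⊥) :
    {M : Ideal R | s.IsStarMaximal M ∧ I ≤ M}.Finite := by
  obtain ⟨x, hx, hx0⟩ := Submodule.exists_mem_ne_zero_of_ne_bot hI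
  exact (hf x hx0).subset fun M hM => ⟨hM.1, hM.2 hx⟩

/-- Two distinct minimal primes of `I` under `M` would be incomparable `*`-primes, hence comaximal,
although both lie in `M`. -/
theorem IsFiniteType.radical_component_mem_minimalPrimes (hs : s.IsFiniteType) (ht : s.IsTreed)
    {I M : Ideal R} (hI : s.IsStarIdeal I) (hM : s.IsStarMaximal M) (hIM : I ≤ M) :
    (component I M).radical ∈ I.minimalPrimes := by
  have := hM.isPrime
  obtain ⟨P, hP, hPM⟩ := Ideal.exists_minimalPrimes_le hIM
  rw [radical_component_eq hM.isPrime hP hPM]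
  · exact hP
  · intro P' hP' hPM'
    by_contra hne
    refine hM.not_comaximal hPM' hPM (ht P' P (hs.isStarPrime_of_mem_minimalPrimes hI hP')
      (hs.isStarPrime_of_mem_minimalPrimes hI hP) (fun h => ?_) fun h => ?_)
    · exact hne (le_antisymm h (hP.2 hP'.1 h))
    · exact hne (le_antisymm (hP'.2 hP.1 h) h)

theorem IsFiniteType.exists_isRepresentation (hs : s.IsFiniteType) (hu : s.UniqueStarMaximal)
    (ht : s.IsTreed) (hf : s.HasFiniteCharacter) {I : Ideal R} (hI : s.IsStarIdeal I) :
    ∃ m, s.IsRepresentation I m := by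
  classical
  let S := (hf.finite_le hI.1).toFinset
  have hS : ∀ {M}, M ∈ S ↔ s.IsStarMaximal M ∧ I ≤ M := by simp [S]
  have hrad : ∀ {M}, M ∈ S → (component I M).radical ∈ I.minimalPrimes := fun hM =>
    hs.radical_component_mem_minimalPrimes ht hI (hS.1 hM).1 (hS.1 hM).2
  have hle : ∀ {M}, M ∈ S → component I M ≤ M := fun hM =>
    component_le (hS.1 hM).1.isPrime (hS.1 hM).1.isPrime (hS.1 hM).2 le_rfl
  -- The component at `M` lies in no other `*`-maximal ideal. This gives comaximality, distinctness
  -- and the local comparison below.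
  have huniq : ∀ {M N}, M ∈ S → s.IsStarMaximal N → component I M ≤ N → N = M := by
    intro M N hM hN h
    exact (hu _ (hs.isStarPrime_of_mem_minimalPrimes hI (hrad hM))).unique
      ⟨hN, hN.isPrime.radical_le_iff.2 h⟩
      ⟨(hS.1 hM).1, (hS.1 hM).1.isPrime.radical_le_iff.2 (hle hM)⟩
  have hstar : ∀ {M}, M ∈ S → s.IsStarIdeal (component I M) := fun hM =>
    hs.isStarIdeal_component hI (hS.1 hM).1.isPrime
  refine ⟨S.val.map (fun M => component I M), ?_, ?_, ?_⟩
  · intro Q hQ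
    obtain ⟨M, hM, rfl⟩ := Multiset.mem_map.1 hQ
    exact ⟨hstar hM, (hrad hM).1.1⟩
  · refine Multiset.Nodup.pairwise ?_ (Multiset.Nodup.map_on ?_ S.nodup)
    · intro Q hQ Q' hQ' hne
      obtain ⟨M, hM, rfl⟩ := Multiset.mem_map.1 hQ
      obtain ⟨M', hM', rfl⟩ := Multiset.mem_map.1 hQ'
      refine hs.comaximal (hstar hM).1 fun N hN h h' => hne ?_
      rw [← huniq hM hN h, huniq hM' hN h']
    · intro M hM M' hM' h
      exact huniq hM' (hS.1 hM').1 (hle hM') |>.symm ▸ huniq hM' (hS.1 hM).1 (h ▸ hle hM)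
  · rw [isStarProduct_iff]
    change s.clIdeal (∏ M ∈ S, component I M) = I
    have h0 : ∏ M ∈ S, component I M ≠ ⊥ := by
      rw [← Ideal.zero_eq_bot, Finset.prod_ne_zero_iff]
      exact fun M hM => (hstar hM).1
    refine le_antisymm (hI.clIdeal_le fun x hx => ?_) fun x hx => ?_
    · refine hs.mem_of_forall_isStarMaximal hI fun N hN => ?_
      by_cases hIN : I ≤ N
      · exact (mem_component hN.isPrime).1
          (Finset.inf_le (f := fun M => component I M) (hS.2 ⟨hN, hIN⟩) (Ideal.prod_le_inf hx))
      · obtain ⟨z, hz, hzN⟩ := SetLike.not_le_iff_exists.1 hIN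
        exact ⟨z, hzN, I.mul_mem_right _ hz⟩
    · refine hs.mem_of_forall_isStarMaximal (isStarIdeal_clIdeal h0) fun N hN => ?_
      by_cases hIN : I ≤ N
      · have hNS : N ∈ S := hS.2 ⟨hN, hIN⟩
        -- At `N` only the component at `N` survives: the other factors contribute a denominator
        -- outside `N`.
        have h1 : ¬ ∏ M ∈ S.erase N, component I M ≤ N := by
          rw [hN.isPrime.prod_le]
          rintro ⟨M, hM, hMN⟩
          exact (Finset.ne_of_mem_erase hM) (huniq (Finset.mem_of_mem_erase hM) hN hMN).symm
        obtain ⟨y, hy, hyN⟩ := SetLike.not_le_iff_exists.1 h1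
        refine ⟨y, hyN, s.le_clIdeal _ ?_⟩
        rw [← Finset.mul_prod_erase S _ hNS, mul_comm y]
        exact Ideal.mul_mem_mul (le_component I hN.isPrime hx) hy
      · have h1 : ¬ ∏ M ∈ S, component I M ≤ N := by
          rw [hN.isPrime.prod_le]
          rintro ⟨M, hM, hMN⟩
          exact hIN ((le_component I (hS.1 hM).1.isPrime).trans hMN)
        obtain ⟨y, hy, hyN⟩ := SetLike.not_le_iff_exists.1 h1
        exact ⟨y, hyN, s.le_clIdeal _ (Ideal.mul_mem_right _ _ hy)⟩

/-! ### From representations of principal ideals to treedness and finite character -/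

theorem IsFiniteType.isTreed (hs : s.IsFiniteType)
    (h : ∀ x : R, x ≠ 0 → ¬ IsUnit x → ∃ m, s.IsRepresentation (Ideal.span {x}) m) :
    s.IsTreed := by
  intro P Q hP hQ hPQ hQP
  refine hs.comaximal hP.2.1 fun M hM hPM hQM => ?_
  obtain ⟨a, haP, haQ⟩ := SetLike.not_le_iff_exists.1 hPQ
  obtain ⟨b, hbQ, hbP⟩ := SetLike.not_le_iff_exists.1 hQP
  -- At `M` the factor `B` agrees with `abR ⊆ A`, so `B.radical ≤ A` for every prime `A ≤ M`
  -- containing `ab`.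
  have key : ∀ {A : Ideal R} {x : R}, A.IsPrime → A ≤ M → a * b ∈ A → x ∉ A → ∀ {B : Ideal R}
      {m : Multiset (Ideal R)}, s.IsRepresentation (Ideal.span {a * b}) m → B ∈ m → B ≤ M →
      x ∉ B.radical := by
    rintro A x hA hAM hab hxA B m hm hB hBM ⟨n, hn⟩
    obtain ⟨y, hy, h1⟩ := hm.exists_notMem_mul_mem hM hB hBM
    have h2 : y * x ^ n ∈ A := (Ideal.span_singleton_le_iff_mem A).2 hab (h1 _ hn)
    exact (hA.mem_or_mem h2).elim (fun h => hy (hAM h)) fun h => hxA (hA.mem_of_pow_mem n h)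
  have hab0 : a * b ≠ 0 := mul_ne_zero (fun h => haQ (h ▸ Q.zero_mem))
    fun h => hbP (h ▸ P.zero_mem)
  have habP : a * b ∈ P := P.mul_mem_right _ haP
  have habQ : a * b ∈ Q := Q.mul_mem_left _ hbQ
  obtain ⟨m, hm⟩ := h (a * b) hab0 fun hu =>
    hM.prop.2 (Ideal.eq_top_of_isUnit_mem M (hPM habP) hu)
  have hspan : Ideal.span {a * b} ≤ M := (Ideal.span_singleton_le_iff_mem M).2 (hPM habP)
  obtain ⟨B, hB, hBM⟩ := hm.exists_le hM.isPrime hspan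
  have hmem : a * b ∈ B.radical :=
    Ideal.le_radical (hm.le_of_mem hB (Ideal.mem_span_singleton_self _))
  exact ((hm.1 B hB).2.mem_or_mem hmem).elim (key hQ.1 hQM habQ haQ hm hB hBM)
    (key hP.1 hPM habP hbP hm hB hBM)

theorem IsFiniteType.hasFiniteCharacter (hs : s.IsFiniteType) (hu : s.UniqueStarMaximal)
    (h : ∀ x : R, x ≠ 0 → ¬ IsUnit x → ∃ m, s.IsRepresentation (Ideal.span {x}) m) :
    s.HasFiniteCharacter := by
  intro x hx
  by_cases hxu : IsUnit x
  · refine Set.finite_empty.subset fun M hM => ?_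
    exact hM.1.prop.2 (Ideal.eq_top_of_isUnit_mem M hM.2 hxu)
  obtain ⟨m, hm⟩ := h x hx hxu
  -- `M ↦ component (xR) M` lands in the finite `m` and is injective, since the radical of a factor
  -- lies in only one `*`-maximal ideal.
  refine Set.Finite.of_finite_fibers (f := fun M => component (Ideal.span {x}) M) ?_ ?_
  · refine (Set.Finite.subset (Multiset.finite_toSet m) ?_)
    rintro _ ⟨M, hM, rfl⟩
    exact (hs.mem_iff_of_isRepresentation hu hm).2
      ⟨M, hM.1, (Ideal.span_singleton_le_iff_mem M).2 hM.2, rfl⟩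
  · rintro _ ⟨M, hM, rfl⟩
    refine Set.Subsingleton.finite ?_
    have hQ := (hs.mem_iff_of_isRepresentation hu hm).2
      ⟨M, hM.1, (Ideal.span_singleton_le_iff_mem M).2 hM.2, rfl⟩
    have hle : ∀ {N}, s.IsStarMaximal N → x ∈ N →
        component (Ideal.span {x}) N = component (Ideal.span {x}) M →
        (component (Ideal.span {x}) M).radical ≤ N := fun hN hxN h =>
      hN.isPrime.radical_le_iff.2 (h ▸ component_le hN.isPrime hN.isPrime
        ((Ideal.span_singleton_le_iff_mem _).2 hxN) le_rfl)
    rintro N ⟨hN, hNM⟩ N' ⟨hN', hNM'⟩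
    exact (hu _ (hs.isStarPrime_radical (hm.1 _ hQ).1 (hm.1 _ hQ).2)).unique
      ⟨hN.1, hle hN.1 hN.2 hNM⟩ ⟨hN'.1, hle hN'.1 hN'.2 hNM'⟩

/-! ### Packets and the equivalences -/

theorem IsRepresentation.isPacket {I Q : Ideal R} {m : Multiset (Ideal R)}
    (h : s.IsRepresentation I m) (hI0 : I ≠ ⊥) (hI : s.IsInvertible I) (hQ : Q ∈ m) :
    s.IsPacket Q := by
  refine ⟨(h.1 Q hQ).1, ?_, existsUnique_minimalPrimes_iff.2 (h.1 Q hQ).2⟩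
  obtain ⟨m', rfl⟩ := Multiset.exists_cons_of_mem hQ
  refine hI.of_clIdeal_mul_eq hI0 (h.1 Q hQ).1.1 (J := m'.prod) ?_
  rw [← Multiset.prod_cons]
  exact s.isStarProduct_iff.1 h.2.2

theorem IsPacket.isStarIdeal_and_isPrime_radical {Q : Ideal R} (h : s.IsPacket Q) :
    s.IsStarIdeal Q ∧ Q.radical.IsPrime :=
  ⟨h.1, existsUnique_minimalPrimes_iff.1 h.2.2⟩

theorem IsFiniteType.isTreed_and_hasFiniteCharacter (hs : s.IsFiniteType)
    (hu : s.UniqueStarMaximal)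
    (h : ∀ I : Ideal R, s.IsStarIdeal I → I ≠ ⊤ → s.IsInvertible I →
      ∃ m, s.IsRepresentation I m) :
    s.IsTreed ∧ s.HasFiniteCharacter := by
  have h' : ∀ x : R, x ≠ 0 → ¬ IsUnit x → ∃ m, s.IsRepresentation (Ideal.span {x}) m :=
    fun x hx hxu => h _ (isStarIdeal_span_singleton hx)
      (by rwa [Ne, Ideal.span_singleton_eq_top]) (isInvertible_span_singleton hx)
  exact ⟨hs.isTreed h', hs.hasFiniteCharacter hu h'⟩

theorem IsFiniteType.tfae (hs : s.IsFiniteType) (hu : s.UniqueStarMaximal) :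
    List.TFAE [
      s.IsTreed ∧ s.HasFiniteCharacter,
      s.IsURD,
      ∀ I : Ideal R, s.IsStarIdeal I → I ≠ ⊤ → ∃! m, s.IsRepresentation I m] := by
  tfae_have 1 → 3 := by
    rintro ⟨ht, hf⟩ I hI -
    obtain ⟨m, hm⟩ := hs.exists_isRepresentation hu ht hf hI
    exact ⟨m, hm, fun m' hm' => hs.isRepresentation_unique hu hm' hm⟩
  tfae_have 3 → 2 := by
    intro h I hI hI1 hinv
    obtain ⟨m, hm, huniq⟩ := h I hI hI1
    refine ⟨m, ⟨fun Q hQ => hm.isPacket hI.1 hinv hQ, hm.2⟩, fun m' hm' => huniq m' ?_⟩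
    -- A factorization into packets is a representation, so uniqueness is inherited.
    exact ⟨fun Q hQ => (hm'.1 Q hQ).isStarIdeal_and_isPrime_radical, hm'.2⟩
  tfae_have 2 → 1 := by
    intro h
    refine hs.isTreed_and_hasFiniteCharacter hu fun I hI hI1 hinv => ?_
    obtain ⟨m, hm, -⟩ := h I hI hI1 hinv
    exact ⟨m, fun Q hQ => (hm.1 Q hQ).isStarIdeal_and_isPrime_radical, hm.2⟩
  tfae_finish

theorem IsFiniteType.uniqueStarMaximal (hs : s.IsFiniteType) (hi : s.IsIndependent) :
    s.UniqueStarMaximal := by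
  intro P hP
  obtain ⟨M, hM, hPM⟩ := hs.exists_isStarMaximal hP.2 hP.1.ne_top
  refine ⟨M, ⟨hM, hPM⟩, fun N hN => ?_⟩
  by_contra hne
  exact hi N M hN.1 hM hne P hP (le_inf hN.2 hPM)

theorem IsFiniteType.isURD_iff (hs : s.IsFiniteType) (hi : s.IsIndependent)
    (hf : s.HasFiniteCharacter) : s.IsURD ↔ s.IsTreed :=
  ((hs.tfae (hs.uniqueStarMaximal hi)).out 1 0).trans (and_iff_left hf)

end StarOperation

theorem mainTheorem7 {R : Type*} [CommRing R] [IsDomain R] {K : Type*} [Field K] [Algebra R K]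
    [IsFractionRing R K] :
    (∀ s : StarOperation R K, s.IsFiniteType →
      (∀ P : Ideal R, s.IsStarPrime P → ∃! M : Ideal R, s.IsStarMaximal M ∧ P ≤ M) →
      List.TFAE [
        s.IsTreed ∧ s.HasFiniteCharacter,
        s.IsURD,
        ∀ I : Ideal R, s.IsStarIdeal I → I ≠ ⊤ →
          ∃! m : Multiset (Ideal R),
            (∀ Q ∈ m, s.IsStarIdeal Q ∧ Q.radical.IsPrime) ∧
              m.Pairwise s.Comaximal ∧ s.IsStarProduct I m]) ∧
    (∀ s : StarOperation R K, s.IsFiniteType → s.IsIndependent → s.HasFiniteCharacter →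
      (s.IsURD ↔ s.IsTreed)) ∧
    (IsWeaklyMatlis R K →
      ((StarOperation.t R K).IsURD ↔ (StarOperation.t R K).IsTreed)) := by
  refine ⟨fun s hs hu => hs.tfae hu, fun s hs => hs.isURD_iff, fun h => ?_⟩
  exact (StarOperation.finite_isFiniteType _).isURD_iff h.1 h.2
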